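/- For $k\in\mathbb N$ and $x\ge 0$ let $\mathcal L_k(x)=(-1)^kL_k(x)e^{-x/2}$, where $L_k(x)=\sum_{l=0}^k\frac{(-1)^l}{l!}\binom kl x^l$ is the $k$-th Laguerre polynomial. Fix an integer $n\ge 1$. Call a real sequence $(F_k)_{k\in\mathbb N}\in\ell^2(\mathbb N)$ LP-feasible if $\sum_kF_k=1$, $F_k\ge0$ for all $k$, and $\sum_kF_k\mathcal L_k(x)\ge0$ (the series being convergent) for all $x\ge0$. Let $(\mathrm{LP}_n^{L^2})$ be the problem of maximising $F_n$ over all LP-feasible sequences, and $\omega_n^{L^2}$ its optimal value (supremum). For $m\ge n$, let $(\mathrm{SDP}_n^{m,\ge})$ be the problem of maximising $F_n$ over all pairs $(A,\boldsymbol F)$, where $A=(A_{ij})_{0\le i,j\le m}$ is a real symmetric matrix and $\boldsymbol F=(F_0,\dots,F_m)\in\mathbb R^{m+1}$, subject to $\sum_{k=0}^mF_k=1$; $F_k\ge0$ for $0\le k\le m$; $A_{ij}=\sum_{k=0}^lF_k\binom lk l!$ whenever $i+j=2l$ with $0\le l\le m$; $A_{ij}=0$ whenever $i+j$ is odd; and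 $A\succeq0$. Let $\omega_n^{m,\ge}$ be its optimal value. Then all these optimal values are finite, that is, each program is feasible and its objective is bounded above on the feasible set; the sequence $(\omega_n^{m,\ge})_{m\ge n}$ is non-increasing; $\omega_n^{L^2}\le\omega_n^{m,\ge}$ for all $m\ge n$; and $$\lim_{m\to\infty}\omega_n^{m,\ge}=\omega_n^{L^2}.$$ The same holds for weighted witnesses: let $\boldsymbol a=(a_1,\dots,a_n)\in[0,1]^n$, and let $\omega_{\boldsymbol a}^{L^2}$ and $\omega_{\boldsymbol a}^{m,\ge}$ be the optimal values of the programs obtained from $(\mathrm{LP}_n^{L^2})$ and $(\mathrm{SDP}_n^{m,\ge})$ by replacing the objective $F_n$ with $\sum_{k=1}^na_kF_k$. These values are finite, $(\omega_{\boldsymbol a}^{m,\ge})_{m\ge n}$ is non-increasing, $\omega_{\boldsymbol a}^{L^2}\le\omega_{\boldsymbol a}^{m,\ge}$ for all $m\ge n$, and $\lim_{m\to\infty}\omega_{\boldsymbol a}^{m,\ge}=\omega_{\boldsymbol a}^{L^2}$. -/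

import Mathlib

open Filter Topology

noncomputable section

namespace WignerHierarchy

/-- The `k`-th Laguerre polynomial `L_k(x) = ∑_{l=0}^k ((-1)^l / l!) (k choose l) x^l`. -/
def laguerre (k : ℕ) (x : ℝ) : ℝ :=
  ∑ l ∈ Finset.range (k + 1), (-1 : ℝ) ^ l / (l.factorial : ℝ) * (k.choose l : ℝ) * x ^ l

/-- The `k`-th (signed) Laguerre function `𝓛_k(x) = (-1)^k L_k(x) e^{-x/2}`. -/
def laguerreFun (k : ℕ) (x : ℝ) : ℝ :=
  (-1 : ℝ) ^ k * laguerre k x * Real.exp (-x / 2)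

/-- Feasible points of the infinite-dimensional linear program. The constraint on the series
`∑_k F_k 𝓛_k(x)` is that it converges and that its sum is non-negative. -/
structure LPFeasible (F : ℕ → ℝ) : Prop where
  mem_l2 : Memℓp F 2
  hasSum_one : HasSum F 1
  nonneg : ∀ k, 0 ≤ F k
  summable_laguerre : ∀ x : ℝ, 0 ≤ x → Summable fun k => F k * laguerreFun k x
  laguerre_nonneg : ∀ x : ℝ, 0 ≤ x → 0 ≤ ∑' k, F k * laguerreFun k x

/-- Feasible points `(A, F)` of the semidefinite relaxation of order `m`;
matrix and vector indices run from `0` to `m`. -/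
structure SDPFeasible (m : ℕ) (A : Matrix (Fin (m + 1)) (Fin (m + 1)) ℝ)
    (F : Fin (m + 1) → ℝ) : Prop where
  isSymm : A.IsSymm
  sum_eq_one : ∑ k, F k = 1
  nonneg : ∀ k, 0 ≤ F k
  even_entries : ∀ l i j : Fin (m + 1), (i : ℕ) + (j : ℕ) = 2 * (l : ℕ) →
    A i j = ∑ k ∈ Finset.Iic l, F k * ((l : ℕ).choose (k : ℕ) : ℝ) * ((l : ℕ).factorial : ℝ)
  odd_entries : ∀ l : ℕ, 1 ≤ l → l ≤ m → ∀ i j : Fin (m + 1),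
    (i : ℕ) + (j : ℕ) + 1 = 2 * l → A i j = 0
  posSemidef : A.PosSemidef

/-- Objective values `F_n` over the feasible points of the linear program. -/
def lpValues (n : ℕ) : Set ℝ :=
  {v | ∃ F : ℕ → ℝ, LPFeasible F ∧ v = F n}

/-- Objective values `F_n` over the feasible points of the relaxation of order `m ≥ n`. -/
def sdpValues (n m : ℕ) : Set ℝ :=
  {v | ∃ (A : Matrix (Fin (m + 1)) (Fin (m + 1)) ℝ) (F : Fin (m + 1) → ℝ),
    SDPFeasible m A F ∧ ∃ h : n ≤ m, v = F ⟨n, Nat.lt_succ_of_le h⟩}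

/-- The optimal value of the linear program maximising `F_n`. -/
def lpOpt (n : ℕ) : ℝ := sSup (lpValues n)

/-- The optimal value of the semidefinite relaxation of order `m` maximising `F_n`. -/
def sdpOpt (n m : ℕ) : ℝ := sSup (sdpValues n m)

/-- Objective values `∑_{k=1}^n a_k F_k` over the feasible points of the linear program;
the weight `a_k` is `a ⟨k - 1, _⟩`. -/
def lpValuesWeighted {n : ℕ} (a : Fin n → ℝ) : Set ℝ :=
  {v | ∃ F : ℕ → ℝ, LPFeasible F ∧ v = ∑ i : Fin n, a i * F ((i : ℕ) + 1)}

/-- Objective values `∑_{k=1}^n a_k F_k` over the feasible points of the relaxation of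
order `m ≥ n`; the weight `a_k` is `a ⟨k - 1, _⟩`. -/
def sdpValuesWeighted {n : ℕ} (a : Fin n → ℝ) (m : ℕ) : Set ℝ :=
  {v | ∃ (A : Matrix (Fin (m + 1)) (Fin (m + 1)) ℝ) (F : Fin (m + 1) → ℝ),
    SDPFeasible m A F ∧ ∃ h : n ≤ m, v = ∑ i : Fin n, a i *
      F ⟨(i : ℕ) + 1, Nat.succ_lt_succ (Nat.lt_of_lt_of_le i.isLt h)⟩}

/-- The optimal value of the linear program maximising `∑_{k=1}^n a_k F_k`. -/
def lpOptWeighted {n : ℕ} (a : Fin n → ℝ) : ℝ := sSup (lpValuesWeighted a)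

/-- The optimal value of the relaxation of order `m` maximising `∑_{k=1}^n a_k F_k`. -/
def sdpOptWeighted {n : ℕ} (a : Fin n → ℝ) (m : ℕ) : ℝ := sSup (sdpValuesWeighted a m)

end WignerHierarchy

end

namespace WignerHierarchy

open Finset MeasureTheory Polynomial

/-! For `F ≥ 0` with sum 1, put f = ∑ F_k 𝓛_k. Since |𝓛_k| ≤ 1 on the half line
(`abs_laguerreFun_le`), f is continuous and bounded there. Its moments against x^l e^{-x/2} are the
finite sums ∑_{k≤l} F_k (l choose k) l!, the numbers prescribed as entries of A. So the matrix of
order m is the moment matrix of f e^{-x/2} dx pulled back evenly under y ↦ y², which explains the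
vanishing odd entries.

If f ≥ 0, all these matrices are positive semidefinite. Conversely, positivity at every order gives
∫ p² f e^{-x/2} ≥ 0 for all polynomials p. As f is bounded and the weight decays exponentially, p
can be replaced by any continuous function of e^{-x/16}, and a bump near a point where f < 0 yields
a contradiction (`nonneg_of_integral_sq_eval_nonneg`). Thus LP feasibility is feasibility at every
order (`lpFeasible_iff`).

Convergence is then compactness. Near-optimal points of the relaxations lie in the product [0,1]^ℕ,
so a subsequence converges coordinatewise. Every moment is a finite sum, so positivity survives;
only total mass can be lost. Mass added to F_0 adds a multiple of the positive semidefinite matrix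
with moments l! and leaves the objective, which starts at F_1, unchanged. The same repair makes
truncated sequences feasible, which gives monotonicity and the bound by the LP value. -/

/-! ### Uniform bound on the Laguerre functions, by a Cauchy estimate -/

/-- The `k`-th derivative at the origin of `z ↦ e^{tz} (z - t)^k` is `k! L_k(t²)`. -/
lemma iteratedDeriv_cexp_mul_sub_pow (k : ℕ) (t : ℝ) :
    iteratedDeriv k (fun z : ℂ => Complex.exp (t * z) * (z - t) ^ k) 0
      = (k.factorial : ℂ) * (laguerre k (t ^ 2) : ℝ) := by
  have h2 : ∀ j, iteratedDeriv j (fun z : ℂ => (z - t) ^ k) 0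
      = (k.descFactorial j : ℂ) * (0 - (t : ℂ)) ^ (k - j) := by
    intro j
    have := congrFun (iteratedDeriv_comp_sub_const j (fun z : ℂ => z ^ k) (t : ℂ)) 0
    rw [this, iteratedDeriv_pow]
  rw [iteratedDeriv_fun_mul (by fun_prop) (by fun_prop)]
  simp only [h2, iteratedDeriv_cexp_const_mul]
  unfold laguerre
  push_cast
  rw [Finset.mul_sum]
  refine Finset.sum_congr rfl fun i hi => ?_
  have hik : i ≤ k := Nat.lt_succ_iff.mp (Finset.mem_range.mp hi)
  have h3 := Nat.factorial_mul_descFactorial (n := k) (k := k - i) (Nat.sub_le _ _)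
  rw [Nat.sub_sub_self hik] at h3 ⊢
  have h4 : (k.factorial : ℂ) = i.factorial * (k.descFactorial (k - i) : ℂ) := by
    exact_mod_cast h3.symm
  have h5 : (i.factorial : ℂ) ≠ 0 := by exact_mod_cast i.factorial_ne_zero
  rw [h4, zero_sub, neg_pow]
  simp only [mul_zero, Complex.exp_zero]
  field_simp
  ring

/-- On the circle, |z - t|² = k(1 + u) ≤ k e^u with u = (t² - 2t Re z)/k. In the k-th power the term
-2t Re z cancels the factor |e^{tz}|² = e^{2t Re z}. The radius √k makes the resulting Cauchy bound
for L_k(t²) exactly e^{t²/2}. -/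
lemma norm_cexp_mul_sub_pow_le {k : ℕ} (hk : 0 < k) (t : ℝ) {z : ℂ} (hz : ‖z‖ = √k) :
    ‖Complex.exp (t * z) * (z - t) ^ k‖ ≤ √k ^ k * Real.exp (t ^ 2 / 2) := by
  have hk' : (0 : ℝ) < k := by exact_mod_cast hk
  refine le_of_sq_le_sq ?_ (by positivity)
  rw [norm_mul, norm_pow, Complex.norm_exp]
  have h1 : ‖z - t‖ ^ 2 ≤ k * Real.exp ((t ^ 2 - 2 * t * z.re) / k) := by
    have h : ‖z - t‖ ^ 2 = k * ((t ^ 2 - 2 * t * z.re) / k + 1) := by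
      have e1 : z.re * z.re + z.im * z.im = k := by
        rw [← Complex.normSq_apply, Complex.normSq_eq_norm_sq, hz, Real.sq_sqrt hk'.le]
      rw [← Complex.normSq_eq_norm_sq, Complex.normSq_apply]
      simp only [Complex.sub_re, Complex.ofReal_re, Complex.sub_im, Complex.ofReal_im, sub_zero]
      field_simp
      linarith
    rw [h]
    exact mul_le_mul_of_nonneg_left (Real.add_one_le_exp _) hk'.le
  have h2 : (‖z - t‖ ^ 2) ^ k ≤ k ^ k * Real.exp (t ^ 2 - 2 * t * z.re) := by
    refine (pow_le_pow_left₀ (by positivity) h1 k).trans_eq ?_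
    rw [mul_pow, ← Real.exp_nat_mul, mul_div_cancel₀ _ hk'.ne']
  have h3 : (Complex.re (t * z)) = t * z.re := by simp
  rw [h3]
  calc (Real.exp (t * z.re) * ‖z - t‖ ^ k) ^ 2
      = Real.exp (2 * t * z.re) * (‖z - t‖ ^ 2) ^ k := by
        rw [mul_pow, ← Real.exp_nat_mul, ← pow_mul, ← pow_mul, mul_comm k 2]
        push_cast; ring_nf
    _ ≤ Real.exp (2 * t * z.re) * (k ^ k * Real.exp (t ^ 2 - 2 * t * z.re)) := by gcongr
    _ = k ^ k * Real.exp (t ^ 2) := by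
        rw [mul_left_comm, ← Real.exp_add]; ring_nf
    _ = (√k ^ k * Real.exp (t ^ 2 / 2)) ^ 2 := by
        rw [mul_pow, ← pow_mul, mul_comm k 2, pow_mul, Real.sq_sqrt hk'.le, ← Real.exp_nat_mul]
        push_cast; ring_nf

lemma abs_laguerre_le (k : ℕ) {x : ℝ} (hx : 0 ≤ x) : |laguerre k x| ≤ Real.exp (x / 2) := by
  -- The case k = 0 is separate because the Cauchy estimate needs a positive radius √k.
  rcases Nat.eq_zero_or_pos k with rfl | hk
  · simpa [laguerre] using (by positivity : (0 : ℝ) ≤ x / 2)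
  have hk' : (0 : ℝ) < √k := Real.sqrt_pos.mpr (by exact_mod_cast hk)
  have h := Complex.norm_iteratedDeriv_le_of_forall_mem_sphere_norm_le (c := 0) (R := √k)
    (C := √k ^ k * Real.exp (√x ^ 2 / 2))
    (f := fun z : ℂ => Complex.exp ((√x : ℝ) * z) * (z - (√x : ℝ)) ^ k) k hk'
    (Differentiable.diffContOnCl (by fun_prop))
    (fun z hz => norm_cexp_mul_sub_pow_le hk _ (by simpa using hz))
  rw [iteratedDeriv_cexp_mul_sub_pow, Real.sq_sqrt hx, norm_mul, Complex.norm_natCast,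
    Complex.norm_real, Real.norm_eq_abs] at h
  have hf : (0 : ℝ) < k.factorial := by exact_mod_cast k.factorial_pos
  have e : k.factorial * (√k ^ k * Real.exp (x / 2)) / √k ^ k
      = k.factorial * Real.exp (x / 2) := by
    field_simp
  rw [e] at h
  exact le_of_mul_le_mul_left h hf

lemma abs_laguerreFun_le (k : ℕ) {x : ℝ} (hx : 0 ≤ x) : |laguerreFun k x| ≤ 1 := by
  have h := abs_laguerre_le k hx
  rw [laguerreFun, abs_mul, abs_mul, abs_pow, abs_neg, abs_one, one_pow, one_mul, Real.abs_exp]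
  calc |laguerre k x| * Real.exp (-x / 2) ≤ Real.exp (x / 2) * Real.exp (-x / 2) := by gcongr
    _ = 1 := by rw [← Real.exp_add]; simp [neg_div]

@[fun_prop]
lemma continuous_laguerre (k : ℕ) : Continuous (laguerre k) := by
  unfold laguerre; fun_prop

@[fun_prop]
lemma continuous_laguerreFun (k : ℕ) : Continuous (laguerreFun k) := by
  unfold laguerreFun; fun_prop

/-! ### Moments -/

lemma integrableOn_pow_mul_exp_neg_mul (l : ℕ) {r : ℝ} (hr : 0 < r) :
    IntegrableOn (fun x : ℝ => x ^ l * Real.exp (-(r * x))) (Set.Ioi 0) := by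
  have h := integrableOn_rpow_mul_exp_neg_mul_rpow (s := l) (p := 1) (b := r)
    (by have : (0 : ℝ) ≤ l := Nat.cast_nonneg l
        linarith) one_pos hr
  simpa using h

lemma integral_pow_mul_exp_neg (l : ℕ) :
    ∫ x : ℝ in Set.Ioi 0, x ^ l * Real.exp (-x) = l.factorial := by
  have h := Real.integral_rpow_mul_exp_neg_mul_Ioi (a := l + 1) (r := 1) (by positivity) one_pos
  simpa [Real.Gamma_nat_eq_factorial] using h

lemma fwdDiff_iter_choose_of_lt {k l : ℕ} (h : l < k) :
    (fwdDiff 1)^[k] (fun x : ℕ => (x.choose l : ℤ)) = 0 := by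
  obtain ⟨d, rfl⟩ := Nat.exists_eq_add_of_lt h
  have h0 : (fwdDiff 1)^[l + 1] (fun x : ℕ => (x.choose l : ℤ)) = 0 := by
    rw [Function.iterate_succ_apply']
    have := fwdDiff_iter_choose 0 l
    rw [add_zero] at this
    rw [this]
    funext x
    simp [fwdDiff]
  rw [show l + d + 1 = d + (l + 1) by ring, Function.iterate_add_apply, h0]
  clear h h0
  induction d with
  | zero => rfl
  | succ d ih => rw [Function.iterate_succ_apply', ih]; funext x; simp [fwdDiff]

lemma fwdDiff_iter_choose_self (k l : ℕ) :
    (fwdDiff 1)^[k] (fun x : ℕ => (x.choose l : ℤ)) l = l.choose k := by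
  rcases le_or_gt k l with h | h
  · obtain ⟨d, rfl⟩ := Nat.exists_eq_add_of_le h
    rw [fwdDiff_iter_choose, Nat.choose_symm_add]
  · rw [fwdDiff_iter_choose_of_lt h, Nat.choose_eq_zero_of_lt h]; rfl

/-- Up to the sign (-1)^k, the left side is the k-th forward difference of x ↦ (x choose l) at x =
l. Each difference lowers the lower index by one, leaving (l choose l - k) = (l choose k), or 0 when
k > l. -/
lemma sum_neg_one_pow_choose_mul_choose (k l : ℕ) :
    ∑ j ∈ range (k + 1), (-1 : ℝ) ^ j * (k.choose j : ℝ) * ((l + j).choose l : ℝ)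
      = (-1) ^ k * l.choose k := by
  have h := fwdDiff_iter_choose_self k l
  rw [fwdDiff_iter_eq_sum_shift] at h
  have h' := congrArg (Int.cast : ℤ → ℝ) h
  push_cast at h'
  rw [← h', Finset.mul_sum]
  refine Finset.sum_congr rfl fun j hj => ?_
  have hjk : j ≤ k := Nat.lt_succ_iff.mp (Finset.mem_range.mp hj)
  have e : (-1 : ℝ) ^ k * (-1) ^ (k - j) = (-1) ^ j := by
    obtain ⟨d, rfl⟩ := Nat.exists_eq_add_of_le hjk
    rw [Nat.add_sub_cancel_left, pow_add, mul_assoc, ← mul_pow]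
    simp
  rw [← e]
  simp
  ring

/-- The moments of the `k`-th Laguerre function against `x^l e^{-x/2}`. -/
lemma integral_pow_mul_laguerreFun (k l : ℕ) :
    ∫ x : ℝ in Set.Ioi 0, x ^ l * (laguerreFun k x * Real.exp (-x / 2))
      = l.choose k * l.factorial := by
  have e : ∀ x : ℝ, x ^ l * (laguerreFun k x * Real.exp (-x / 2))
      = ∑ j ∈ range (k + 1), ((-1) ^ k * ((-1 : ℝ) ^ j / j.factorial * k.choose j)) *
        (x ^ (l + j) * Real.exp (-x)) := by
    intro x
    have h2 : Real.exp (-x) = Real.exp (-x / 2) * Real.exp (-x / 2) := by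
      rw [← Real.exp_add]; ring_nf
    rw [h2, laguerreFun, laguerre, Finset.mul_sum, Finset.sum_mul, Finset.sum_mul, Finset.mul_sum]
    refine Finset.sum_congr rfl fun j _ => ?_
    rw [pow_add]; ring
  simp_rw [e]
  rw [integral_finsetSum _ fun j _ => (by
    simpa using (integrableOn_pow_mul_exp_neg_mul (l + j) one_pos).const_mul _)]
  simp_rw [integral_const_mul, integral_pow_mul_exp_neg]
  have h := sum_neg_one_pow_choose_mul_choose k l
  have e2 : ((l.choose k : ℝ)) = (-1) ^ k * ((-1) ^ k * l.choose k) := by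
    rw [← mul_assoc, ← mul_pow]; simp
  rw [e2, ← h, Finset.mul_sum, Finset.sum_mul]
  refine Finset.sum_congr rfl fun j _ => ?_
  have h3 := Nat.add_choose_mul_factorial_mul_factorial l j
  rw [← Nat.choose_symm_add] at h3
  have h4 : ((l + j).factorial : ℝ) = (l + j).choose l * l.factorial * j.factorial := by
    exact_mod_cast h3.symm
  have h5 : (j.factorial : ℝ) ≠ 0 := by exact_mod_cast j.factorial_ne_zero
  rw [h4]
  field_simp

/-! ### Hankel matrices of Stieltjes type -/

/-- The moment sequence `μ_l = ∑_{k ≤ l} F_k (l choose k) l!`. -/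
noncomputable def fockMoment (F : ℕ → ℝ) (l : ℕ) : ℝ :=
  ∑ k ∈ range (l + 1), F k * (l.choose k : ℝ) * (l.factorial : ℝ)

/-- The Hankel matrix of the symmetric moment sequence with even moments `μ`. -/
noncomputable def stieltjesMatrix (μ : ℕ → ℝ) (m : ℕ) : Matrix (Fin (m + 1)) (Fin (m + 1)) ℝ :=
  Matrix.of fun i j => if Even ((i : ℕ) + j) then μ (((i : ℕ) + j) / 2) else 0

lemma stieltjesMatrix_isSymm (μ : ℕ → ℝ) (m : ℕ) : (stieltjesMatrix μ m).IsSymm := by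
  ext i j
  simp [stieltjesMatrix, add_comm]

lemma posSemidef_stieltjesMatrix_iff (μ : ℕ → ℝ) (m : ℕ) :
    (stieltjesMatrix μ m).PosSemidef ↔
      ∀ v : Fin (m + 1) → ℝ, 0 ≤ ∑ i, ∑ j, v i * v j * stieltjesMatrix μ m i j := by
  have e : ∀ v : Fin (m + 1) → ℝ, star v ⬝ᵥ (stieltjesMatrix μ m).mulVec v
      = ∑ i, ∑ j, v i * v j * stieltjesMatrix μ m i j := by
    intro v
    simp only [dotProduct, Matrix.mulVec, Finset.mul_sum, star_trivial]
    exact Finset.sum_congr rfl fun i _ => Finset.sum_congr rfl fun j _ => by ring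
  constructor
  · intro h v
    rw [← e]
    exact h.dotProduct_mulVec_nonneg v
  · intro h
    refine Matrix.PosSemidef.of_dotProduct_mulVec_nonneg ?_ fun v => by rw [e]; exact h v
    exact (Matrix.conjTranspose_eq_transpose_of_trivial _).trans (stieltjesMatrix_isSymm μ m)

/-- With q(y) = ∑ v_i y^i, the quadratic form is ∫ (q(√x)² + q(-√x)²)/2 · w(x) dx. Averaging over
±√x kills the odd powers. -/
lemma posSemidef_stieltjesMatrix_of_moments {w : ℝ → ℝ} {μ : ℕ → ℝ}
    (hw : ∀ x, 0 < x → 0 ≤ w x)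
    (hint : ∀ l : ℕ, IntegrableOn (fun x => x ^ l * w x) (Set.Ioi 0))
    (hμ : ∀ l : ℕ, ∫ x in Set.Ioi 0, x ^ l * w x = μ l) (m : ℕ) :
    (stieltjesMatrix μ m).PosSemidef := by
  rw [posSemidef_stieltjesMatrix_iff]
  intro v
  let g : ℕ → ℝ → ℝ := fun n x => if Even n then x ^ (n / 2) * w x else 0
  have hg : ∀ n, IntegrableOn (g n) (Set.Ioi 0) := by
    intro n
    by_cases h : Even n
    · simpa [g, h] using hint (n / 2)
    · simp [g, h]
  have hgi : ∀ i j : Fin (m + 1),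
      stieltjesMatrix μ m i j = ∫ x in Set.Ioi 0, g ((i : ℕ) + j) x := by
    intro i j
    by_cases h : Even ((i : ℕ) + j)
    · simp [stieltjesMatrix, g, h, hμ]
    · simp [stieltjesMatrix, g, h]
  have hgs : ∀ n, ∀ x, 0 < x → g n x = ((√x) ^ n + (-√x) ^ n) / 2 * w x := by
    intro n x hx
    by_cases h : Even n
    · obtain ⟨r, rfl⟩ := h
      have : (√x) ^ (r + r) = x ^ r := by rw [← two_mul, pow_mul, Real.sq_sqrt hx.le]
      have h2 : (r + r) / 2 = r := by omega
      simp [g, this, h2, Even.neg_pow ⟨r, rfl⟩]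
    · simp [g, h, (Nat.not_even_iff_odd.mp h).neg_pow]
  have key : ∑ i, ∑ j, v i * v j * stieltjesMatrix μ m i j
      = ∫ x in Set.Ioi 0, ∑ i : Fin (m + 1), ∑ j : Fin (m + 1), v i * v j * g ((i : ℕ) + j) x := by
    rw [integral_finsetSum _ fun (i : Fin (m + 1)) _ =>
      integrable_finsetSum _ fun (j : Fin (m + 1)) _ => (hg ((i : ℕ) + j)).const_mul _]
    refine Finset.sum_congr rfl fun i _ => ?_
    rw [integral_finsetSum _ fun (j : Fin (m + 1)) _ => (hg ((i : ℕ) + j)).const_mul _]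
    refine Finset.sum_congr rfl fun j _ => ?_
    rw [integral_const_mul, hgi]
  rw [key]
  refine setIntegral_nonneg measurableSet_Ioi fun x hx => ?_
  have e : ∑ i : Fin (m + 1), ∑ j : Fin (m + 1), v i * v j * g ((i : ℕ) + j) x
      = ((∑ i : Fin (m + 1), v i * (√x) ^ (i : ℕ)) ^ 2
        + (∑ i : Fin (m + 1), v i * (-√x) ^ (i : ℕ)) ^ 2) / 2 * w x := by
    rw [sq, sq, Finset.sum_mul_sum, Finset.sum_mul_sum, ← Finset.sum_add_distrib, Finset.sum_div,
      Finset.sum_mul]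
    refine Finset.sum_congr rfl fun i _ => ?_
    rw [← Finset.sum_add_distrib, Finset.sum_div, Finset.sum_mul]
    refine Finset.sum_congr rfl fun j _ => ?_
    rw [hgs _ x hx, pow_add, pow_add]
    ring
  rw [e]
  exact mul_nonneg (by positivity) (hw x hx)

/-- The rows and columns of even index 2i, 2j carry the entries μ_{i+j}, so this principal submatrix
is the ordinary Hankel matrix. The odd-index block, which encodes ∫ x p² w, is not needed for the
converse. -/
lemma hankel_nonneg_of_posSemidef {μ : ℕ → ℝ} {d : ℕ}
    (h : (stieltjesMatrix μ (2 * d)).PosSemidef) (c : ℕ → ℝ) :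
    0 ≤ ∑ i ∈ range (d + 1), ∑ j ∈ range (d + 1), c i * c j * μ (i + j) := by
  have h1 := (h.submatrix (fun i : Fin (d + 1) =>
    (⟨2 * (i : ℕ), by have := i.isLt; omega⟩ : Fin (2 * d + 1)))).dotProduct_mulVec_nonneg
      (fun i => c i)
  simp only [dotProduct, Matrix.mulVec, Finset.mul_sum, star_trivial, Matrix.submatrix_apply,
    stieltjesMatrix, Matrix.of_apply] at h1
  rw [Finset.sum_range fun i => ∑ j ∈ range (d + 1), c i * c j * μ (i + j)]
  refine h1.trans_eq (Finset.sum_congr rfl fun i _ => ?_)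
  rw [Finset.sum_range fun j => c i * c j * μ (i + j)]
  refine Finset.sum_congr rfl fun j _ => ?_
  rw [← mul_add, if_pos (even_two_mul _), Nat.mul_div_cancel_left _ two_pos]
  ring

lemma integral_sq_eval_nonneg {w : ℝ → ℝ} {μ : ℕ → ℝ}
    (hint : ∀ l : ℕ, IntegrableOn (fun x => x ^ l * w x) (Set.Ioi 0))
    (hμ : ∀ l : ℕ, ∫ x in Set.Ioi 0, x ^ l * w x = μ l)
    (h : ∀ m, (stieltjesMatrix μ m).PosSemidef) (p : ℝ[X]) :
    0 ≤ ∫ x in Set.Ioi 0, p.eval x ^ 2 * w x := by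
  refine (hankel_nonneg_of_posSemidef (h (2 * p.natDegree)) p.coeff).trans_eq ?_
  have e : ∀ x : ℝ, p.eval x ^ 2 * w x = ∑ i ∈ range (p.natDegree + 1),
      ∑ j ∈ range (p.natDegree + 1), p.coeff i * p.coeff j * (x ^ (i + j) * w x) := by
    intro x
    rw [Polynomial.eval_eq_sum_range, sq, Finset.sum_mul_sum, Finset.sum_mul]
    refine Finset.sum_congr rfl fun i _ => ?_
    rw [Finset.sum_mul]
    exact Finset.sum_congr rfl fun j _ => by ring
  simp_rw [e]
  rw [integral_finsetSum _ fun i _ =>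
    integrable_finsetSum _ fun j _ => (hint (i + j)).const_mul _]
  refine Finset.sum_congr rfl fun i _ => ?_
  rw [integral_finsetSum _ fun j _ => (hint (i + j)).const_mul _]
  refine Finset.sum_congr rfl fun j _ => ?_
  rw [integral_const_mul, hμ]

/-! ### A bounded function with non-negative moment functional is non-negative -/

lemma integrableOn_exp_neg_mul {r : ℝ} (hr : 0 < r) :
    IntegrableOn (fun x : ℝ => Real.exp (-(r * x))) (Set.Ioi 0) := by
  simpa using integrableOn_pow_mul_exp_neg_mul 0 hr

/-- Dominated convergence: growth e^{x/8} becomes e^{x/4} after squaring, so the weight e^{-x/2}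
still leaves the integrable bound e^{-x/4}. -/
lemma integral_sq_nonneg_of_tendsto {f : ℝ → ℝ} {B C : ℝ}
    (hf : AEStronglyMeasurable f (volume.restrict (Set.Ioi 0)))
    (hB : ∀ x, 0 < x → |f x| ≤ B) {G : ℕ → ℝ → ℝ} {g : ℝ → ℝ} (hG : ∀ N, Continuous (G N))
    (hC : ∀ N x, 0 < x → |G N x| ≤ C * Real.exp (x / 8))
    (hlim : ∀ x, 0 < x → Tendsto (fun N => G N x) atTop (𝓝 (g x)))
    (h : ∀ N, 0 ≤ ∫ x in Set.Ioi 0, G N x ^ 2 * (f x * Real.exp (-x / 2))) :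
    0 ≤ ∫ x in Set.Ioi 0, g x ^ 2 * (f x * Real.exp (-x / 2)) := by
  refine ge_of_tendsto' (tendsto_integral_of_dominated_convergence
    (fun x => C ^ 2 * B * Real.exp (-((1 / 4) * x))) (fun N => ?_) ?_ (fun N => ?_) ?_) h
  · exact ((hG N).pow 2).aestronglyMeasurable.mul
      (hf.mul (by fun_prop : Continuous fun x : ℝ => Real.exp (-x / 2)).aestronglyMeasurable)
  · exact (integrableOn_exp_neg_mul (by norm_num)).const_mul _
  · refine (ae_restrict_iff' measurableSet_Ioi).mpr (Eventually.of_forall fun x hx => ?_)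
    have h1 : G N x ^ 2 ≤ (C * Real.exp (x / 8)) ^ 2 := by
      rw [← sq_abs]
      exact pow_le_pow_left₀ (abs_nonneg _) (hC N x hx) 2
    rw [Real.norm_eq_abs, abs_mul, abs_mul, Real.abs_exp, abs_of_nonneg (sq_nonneg _)]
    calc G N x ^ 2 * (|f x| * Real.exp (-x / 2))
        ≤ (C * Real.exp (x / 8)) ^ 2 * (B * Real.exp (-x / 2)) := by
          gcongr
          exact hB x hx
      _ = C ^ 2 * B * Real.exp (-((1 / 4) * x)) := by
          have : Real.exp (-((1 / 4) * x)) = Real.exp (x / 8) ^ 2 * Real.exp (-x / 2) := by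
            rw [← Real.exp_nat_mul, ← Real.exp_add]; congr 1; push_cast; ring
          rw [this]; ring
  · refine (ae_restrict_iff' measurableSet_Ioi).mpr (Eventually.of_forall fun x hx => ?_)
    exact ((hlim x hx).pow 2).mul_const _

lemma exists_abs_eval_le_mul_exp (p : ℝ[X]) {ε : ℝ} (hε : 0 < ε) :
    ∃ C, 0 ≤ C ∧ ∀ x, 0 ≤ x → |p.eval x| ≤ C * Real.exp (ε * x) := by
  induction p using Polynomial.induction_on' with
  | add p q hp hq =>
    obtain ⟨C, hC0, hC⟩ := hp
    obtain ⟨D, hD0, hD⟩ := hq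
    refine ⟨C + D, by positivity, fun x hx => ?_⟩
    rw [eval_add, add_mul]
    exact (abs_add_le _ _).trans (add_le_add (hC x hx) (hD x hx))
  | monomial n a =>
    refine ⟨|a| * (n.factorial / ε ^ n), by positivity, fun x hx => ?_⟩
    rw [eval_monomial, abs_mul, abs_of_nonneg (pow_nonneg hx n), mul_assoc]
    refine mul_le_mul_of_nonneg_left ?_ (abs_nonneg a)
    have h := Real.pow_div_factorial_le_exp (ε * x) (by positivity) n
    have hn : (0 : ℝ) < n.factorial := by exact_mod_cast n.factorial_pos
    rw [div_le_iff₀ hn, mul_pow] at h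
    rw [div_mul_eq_mul_div, le_div_iff₀ (by positivity)]
    linarith

/-- The Taylor polynomial of `e^{-x/16}`. -/
noncomputable def expTaylor (N : ℕ) : ℝ[X] :=
  ∑ j ∈ range N, C ((-(1 / 16) : ℝ) ^ j / (j.factorial : ℝ)) * X ^ j

lemma eval_expTaylor (N : ℕ) (x : ℝ) :
    (expTaylor N).eval x = ∑ j ∈ range N, (-(x / 16)) ^ j / (j.factorial : ℝ) := by
  rw [expTaylor, eval_finsetSum]
  refine Finset.sum_congr rfl fun j _ => ?_
  rw [show -(x / 16) = -(1 / 16) * x by ring, mul_pow]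
  simp only [eval_mul, eval_C, eval_pow, eval_X]
  ring

lemma abs_eval_expTaylor_le (N : ℕ) {x : ℝ} (hx : 0 ≤ x) :
    |(expTaylor N).eval x| ≤ Real.exp (1 / 16 * x) := by
  rw [eval_expTaylor]
  refine (Finset.abs_sum_le_sum_abs _ _).trans ?_
  refine le_trans (le_of_eq ?_) (Real.sum_le_exp_of_nonneg (x := 1 / 16 * x) (by positivity) N)
  refine Finset.sum_congr rfl fun j _ => ?_
  rw [abs_div, abs_pow, abs_neg, abs_of_nonneg (by positivity : 0 ≤ x / 16), Nat.abs_cast]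
  ring

lemma tendsto_eval_expTaylor (x : ℝ) :
    Tendsto (fun N => (expTaylor N).eval x) atTop (𝓝 (Real.exp (-(x / 16)))) := by
  simp_rw [eval_expTaylor]
  rw [Real.exp_eq_exp_ℝ]
  exact (NormedSpace.expSeries_div_hasSum_exp (-(x / 16))).tendsto_sum_nat

section Positivity

variable {f : ℝ → ℝ} {B : ℝ}

/-- Induction on the degree in e^{-x/16}: a single factor e^{-x/16} is replaced by its Taylor
polynomials, which are absorbed into the polynomial coefficients. Approximating e^{-nx/16} in one go
would cost growth e^{nx/16}, too much for the weight when n is large; one factor at a time costs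
e^{x/16} whatever n is. -/
lemma integral_sq_expPolynomial_nonneg
    (hf : AEStronglyMeasurable f (volume.restrict (Set.Ioi 0))) (hB : ∀ x, 0 < x → |f x| ≤ B)
    (h : ∀ p : ℝ[X], 0 ≤ ∫ x in Set.Ioi 0, p.eval x ^ 2 * (f x * Real.exp (-x / 2)))
    (n : ℕ) (p : ℕ → ℝ[X]) :
    0 ≤ ∫ x in Set.Ioi 0, (∑ i ∈ range (n + 1), (p i).eval x * Real.exp (-(x / 16)) ^ i) ^ 2 *
      (f x * Real.exp (-x / 2)) := by
  induction n generalizing p with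
  | zero => simpa using h (p 0)
  | succ n ih =>
    obtain ⟨C₀, hC₀, h₀⟩ := exists_abs_eval_le_mul_exp (p 0) (ε := 1 / 8) (by norm_num)
    choose D hD hDb using fun i => exists_abs_eval_le_mul_exp (p (i + 1)) (ε := 1 / 16)
      (by norm_num)
    -- One factor e^{-x/16} is pulled out of every term of positive degree and replaced by its
    -- Taylor polynomial; `p 0` joins the new constant coefficient. The rate 1/16 of the Taylor
    -- bound plus 1/16 for the coefficients gives the admissible 1/8.
    let q : ℕ → ℕ → ℝ[X] := fun N i => (if i = 0 then p 0 else 0) + expTaylor N * p (i + 1)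
    have hq : ∀ N x, ∑ i ∈ range (n + 1), (q N i).eval x * Real.exp (-(x / 16)) ^ i
        = (p 0).eval x + (expTaylor N).eval x *
          ∑ i ∈ range (n + 1), (p (i + 1)).eval x * Real.exp (-(x / 16)) ^ i := by
      intro N x
      simp only [q, eval_add, eval_mul, add_mul, Finset.sum_add_distrib, Finset.mul_sum]
      congr 1
      · rw [Finset.sum_eq_single 0] <;> simp +contextual
      · exact Finset.sum_congr rfl fun i _ => by ring
    refine integral_sq_nonneg_of_tendsto hf hB (C := C₀ + ∑ i ∈ range (n + 1), D i)
      (G := fun N x => ∑ i ∈ range (n + 1), (q N i).eval x * Real.exp (-(x / 16)) ^ i)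
      (fun N => by fun_prop) (fun N x hx => ?_) (fun x _ => ?_) fun N => ih (q N)
    · simp only [hq]
      refine (abs_add_le _ _).trans ?_
      rw [add_mul, abs_mul]
      refine add_le_add ((h₀ x hx.le).trans_eq (by ring_nf)) ?_
      have hs : |∑ i ∈ range (n + 1), (p (i + 1)).eval x * Real.exp (-(x / 16)) ^ i|
          ≤ (∑ i ∈ range (n + 1), D i) * Real.exp (1 / 16 * x) := by
        rw [Finset.sum_mul]
        refine (Finset.abs_sum_le_sum_abs _ _).trans (Finset.sum_le_sum fun i _ => ?_)
        rw [abs_mul, abs_pow, Real.abs_exp]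
        refine (mul_le_of_le_one_right (abs_nonneg _) (pow_le_one₀ (Real.exp_pos _).le ?_)).trans
          (hDb i x hx.le)
        rw [Real.exp_le_one_iff]
        linarith
      calc _ ≤ Real.exp (1 / 16 * x) * ((∑ i ∈ range (n + 1), D i) * Real.exp (1 / 16 * x)) :=
            mul_le_mul (abs_eval_expTaylor_le N hx.le) hs (abs_nonneg _) (Real.exp_pos _).le
        _ = (∑ i ∈ range (n + 1), D i) * Real.exp (x / 8) := by
            rw [mul_left_comm, ← Real.exp_add]; ring_nf
    · simp only [hq]
      have hlim := ((tendsto_eval_expTaylor x).mul_const (∑ i ∈ range (n + 1),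
        (p (i + 1)).eval x * Real.exp (-(x / 16)) ^ i)).const_add ((p 0).eval x)
      convert hlim using 2
      rw [Finset.sum_range_succ', Finset.mul_sum, add_comm]
      congr 1
      · simp
      · exact Finset.sum_congr rfl fun i _ => by ring

/-- The map x ↦ e^{-x/16} sends the half line into [0,1], where Weierstrass approximation applies to
φ; polynomials in e^{-x/16} are covered by the previous lemma with constant coefficients. -/
lemma integral_sq_comp_exp_nonneg
    (hf : AEStronglyMeasurable f (volume.restrict (Set.Ioi 0))) (hB : ∀ x, 0 < x → |f x| ≤ B)
    (h : ∀ p : ℝ[X], 0 ≤ ∫ x in Set.Ioi 0, p.eval x ^ 2 * (f x * Real.exp (-x / 2)))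
    {φ : ℝ → ℝ} (hφ : Continuous φ) :
    0 ≤ ∫ x in Set.Ioi 0, φ (Real.exp (-(x / 16))) ^ 2 * (f x * Real.exp (-x / 2)) := by
  choose P hP using fun N : ℕ => exists_polynomial_near_of_continuousOn 0 1 φ hφ.continuousOn
    (1 / ((N : ℝ) + 1)) (by positivity)
  obtain ⟨K, hK⟩ := isCompact_Icc.exists_bound_of_continuousOn (s := Set.Icc (0 : ℝ) 1)
    hφ.continuousOn
  have hmem : ∀ x : ℝ, 0 < x → Real.exp (-(x / 16)) ∈ Set.Icc (0 : ℝ) 1 := fun x hx =>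
    ⟨(Real.exp_pos _).le, by rw [Real.exp_le_one_iff]; linarith⟩
  refine integral_sq_nonneg_of_tendsto hf hB (C := K + 1)
    (G := fun N x => (P N).eval (Real.exp (-(x / 16)))) (fun N => by fun_prop)
    (fun N x hx => ?_) (fun x hx => ?_) fun N => ?_
  · have h1 := hP N _ (hmem x hx)
    have h2 := hK _ (hmem x hx)
    rw [Real.norm_eq_abs] at h2
    have h3 : 1 / ((N : ℝ) + 1) ≤ 1 := by
      rw [div_le_one (by positivity)]
      have : (0 : ℝ) ≤ N := Nat.cast_nonneg N
      linarith
    have h4 : |(P N).eval (Real.exp (-(x / 16)))| ≤ K + 1 := by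
      have := abs_sub_abs_le_abs_sub ((P N).eval (Real.exp (-(x / 16))))
        (φ (Real.exp (-(x / 16))))
      linarith
    exact h4.trans (le_mul_of_one_le_right ((abs_nonneg _).trans h4)
      (Real.one_le_exp (by positivity)))
  · rw [tendsto_iff_dist_tendsto_zero]
    refine squeeze_zero (fun _ => dist_nonneg) (fun N => ?_) tendsto_one_div_add_atTop_nhds_zero_nat
    rw [Real.dist_eq]
    exact (hP N _ (hmem x hx)).le
  · have := integral_sq_expPolynomial_nonneg hf hB h (P N).natDegree fun i => C ((P N).coeff i)
    simpa only [eval_C, ← Polynomial.eval_eq_sum_range] using this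

/-- A bounded continuous function on the half line whose moment functional with respect to
`e^{-x/2}` is non-negative on squares of polynomials is non-negative. -/
theorem nonneg_of_integral_sq_eval_nonneg (hf : ContinuousOn f (Set.Ici 0))
    (hB : ∀ x, 0 ≤ x → |f x| ≤ B)
    (h : ∀ p : ℝ[X], 0 ≤ ∫ x in Set.Ioi 0, p.eval x ^ 2 * (f x * Real.exp (-x / 2)))
    {x₀ : ℝ} (hx₀ : 0 ≤ x₀) : 0 ≤ f x₀ := by
  by_contra! hneg
  have hfm : AEStronglyMeasurable f (volume.restrict (Set.Ioi 0)) :=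
    (hf.mono Set.Ioi_subset_Ici_self).aestronglyMeasurable measurableSet_Ioi
  -- A right neighbourhood is used because x₀ may be the endpoint 0.
  have hev : ∀ᶠ x in 𝓝[>] x₀, f x < 0 :=
    ((hf x₀ hx₀).mono (fun x hx => hx₀.trans (le_of_lt hx))).eventually (gt_mem_nhds hneg)
  obtain ⟨b, hb, hb'⟩ := (mem_nhdsGT_iff_exists_Ioo_subset).mp hev
  -- After the decreasing substitution y = e^{-x/16}, this bump is positive exactly for x in (x₀,
  -- b), where f < 0.
  let φ : ℝ → ℝ := fun y => max 0 ((y - Real.exp (-(b / 16))) * (Real.exp (-(x₀ / 16)) - y))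
  have hφ : Continuous φ := by fun_prop
  have hφ0 : ∀ x, x ∉ Set.Ioo x₀ b → φ (Real.exp (-(x / 16))) = 0 := by
    intro x hx
    refine max_eq_left ?_
    rcases le_or_gt x x₀ with h1 | h1
    · have h2 : Real.exp (-(x₀ / 16)) ≤ Real.exp (-(x / 16)) := Real.exp_le_exp.mpr (by linarith)
      have h3 : Real.exp (-(b / 16)) ≤ Real.exp (-(x / 16)) :=
        Real.exp_le_exp.mpr (by have : x₀ < b := hb
                                linarith)
      exact mul_nonpos_of_nonneg_of_nonpos (by linarith) (by linarith)
    · have h1' : b ≤ x := by by_contra! h4; exact hx ⟨h1, h4⟩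
      have h2 : Real.exp (-(x / 16)) ≤ Real.exp (-(x₀ / 16)) := Real.exp_le_exp.mpr (by linarith)
      have h3 : Real.exp (-(x / 16)) ≤ Real.exp (-(b / 16)) := Real.exp_le_exp.mpr (by linarith)
      exact mul_nonpos_of_nonpos_of_nonneg (by linarith) (by linarith)
  have hφpos : ∀ x ∈ Set.Ioo x₀ b, 0 < φ (Real.exp (-(x / 16))) := by
    intro x hx
    have h2 : Real.exp (-(x / 16)) < Real.exp (-(x₀ / 16)) :=
      Real.exp_lt_exp.mpr (by linarith [hx.1])
    have h3 : Real.exp (-(b / 16)) < Real.exp (-(x / 16)) :=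
      Real.exp_lt_exp.mpr (by linarith [hx.2])
    exact lt_max_of_lt_right (mul_pos (by linarith) (by linarith))
  have hnn := integral_sq_comp_exp_nonneg hfm (fun x hx => hB x hx.le) h hφ
  let g : ℝ → ℝ := fun x => -(φ (Real.exp (-(x / 16))) ^ 2 * (f x * Real.exp (-x / 2)))
  have hgpos : ∀ x ∈ Set.Ioo x₀ b, 0 < g x := fun x hx => neg_pos.mpr
    (mul_neg_of_pos_of_neg (pow_pos (hφpos x hx) 2)
      (mul_neg_of_neg_of_pos (hb' hx) (Real.exp_pos _)))
  have hg0 : ∀ x, 0 ≤ g x := by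
    intro x
    by_cases hx : x ∈ Set.Ioo x₀ b
    · exact (hgpos x hx).le
    · simp [g, hφ0 x hx]
  obtain ⟨K, hK⟩ := isCompact_Icc.exists_bound_of_continuousOn (s := Set.Icc (0 : ℝ) 1)
    hφ.continuousOn
  have hgint : IntegrableOn g (Set.Ioi 0) := by
    refine Integrable.mono' ((integrableOn_exp_neg_mul (r := 1 / 2) (by norm_num)).const_mul
      (K ^ 2 * B)) ?_ ?_
    · exact ((by fun_prop : Continuous fun x : ℝ => φ (Real.exp (-(x / 16))) ^ 2)
        |>.aestronglyMeasurable.mul (hfm.mul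
        (by fun_prop : Continuous fun x : ℝ => Real.exp (-x / 2)).aestronglyMeasurable)).neg
    · refine (ae_restrict_iff' measurableSet_Ioi).mpr (Eventually.of_forall fun x hx => ?_)
      have hx' : 0 < x := hx
      have h2 := hK (Real.exp (-(x / 16)))
        ⟨(Real.exp_pos _).le, by rw [Real.exp_le_one_iff]; linarith⟩
      rw [norm_neg, Real.norm_eq_abs, abs_mul, abs_mul, abs_pow, Real.abs_exp, mul_assoc,
        show -x / 2 = -(1 / 2 * x) by ring]
      exact mul_le_mul (pow_le_pow_left₀ (abs_nonneg _) h2 2)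
        (mul_le_mul_of_nonneg_right (hB x hx'.le) (Real.exp_pos _).le)
        (by positivity) (by positivity)
  have hpos : 0 < ∫ x in Set.Ioi 0, g x := by
    rw [setIntegral_pos_iff_support_of_nonneg_ae (Eventually.of_forall hg0) hgint]
    refine lt_of_lt_of_le ?_ (measure_mono (s := Set.Ioo x₀ b) fun x hx =>
      ⟨(hgpos x hx).ne', hx₀.trans_lt hx.1⟩)
    rw [Real.volume_Ioo, ENNReal.ofReal_pos]
    exact sub_pos.mpr hb
  simp only [g, integral_neg] at hpos
  linarith

end Positivity

/-! ### Laguerre series with summable non-negative coefficients -/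

section LaguerreSeries

variable {F : ℕ → ℝ}

lemma abs_mul_laguerreFun_le (hF : ∀ k, 0 ≤ F k) (k : ℕ) {x : ℝ} (hx : 0 ≤ x) :
    |F k * laguerreFun k x| ≤ F k := by
  rw [abs_mul, abs_of_nonneg (hF k)]
  exact mul_le_of_le_one_right (hF k) (abs_laguerreFun_le k hx)

lemma summable_mul_laguerreFun (hF : ∀ k, 0 ≤ F k) (hs : Summable F) {x : ℝ} (hx : 0 ≤ x) :
    Summable fun k => F k * laguerreFun k x :=
  hs.of_norm_bounded fun k => abs_mul_laguerreFun_le hF k hx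

lemma abs_tsum_mul_laguerreFun_le (hF : ∀ k, 0 ≤ F k) (hs : Summable F) {x : ℝ} (hx : 0 ≤ x) :
    |∑' k, F k * laguerreFun k x| ≤ ∑' k, F k :=
  tsum_of_norm_bounded (f := fun k => F k * laguerreFun k x) hs.hasSum fun k =>
    abs_mul_laguerreFun_le hF k hx

lemma continuousOn_tsum_mul_laguerreFun (hF : ∀ k, 0 ≤ F k) (hs : Summable F) :
    ContinuousOn (fun x => ∑' k, F k * laguerreFun k x) (Set.Ici 0) :=
  continuousOn_tsum (fun k => by fun_prop) hs fun k _ hx => abs_mul_laguerreFun_le hF k hx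

lemma integrableOn_pow_mul_of_bounded {f : ℝ → ℝ} {B : ℝ} (hf : ContinuousOn f (Set.Ici 0))
    (hB : ∀ x, 0 ≤ x → |f x| ≤ B) (l : ℕ) :
    IntegrableOn (fun x => x ^ l * (f x * Real.exp (-x / 2))) (Set.Ioi 0) := by
  refine Integrable.mono' ((integrableOn_pow_mul_exp_neg_mul l (r := 1 / 2)
    (by norm_num)).const_mul B) ?_ ?_
  · have hf' := hf.mono Set.Ioi_subset_Ici_self
    exact ContinuousOn.aestronglyMeasurable (by fun_prop) measurableSet_Ioi
  · refine (ae_restrict_iff' measurableSet_Ioi).mpr (Eventually.of_forall fun x hx => ?_)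
    have hx' : 0 < x := hx
    rw [Real.norm_eq_abs, abs_mul, abs_mul, Real.abs_exp, abs_of_nonneg (pow_nonneg hx'.le l),
      show -x / 2 = -(1 / 2 * x) by ring, mul_left_comm]
    exact mul_le_mul_of_nonneg_right (hB x hx'.le) (by positivity)

/-- The bound |𝓛_k| ≤ 1 and the summability of `F` permit termwise integration; the k-th term
carries (l choose k), so only k ≤ l survive. -/
lemma integral_pow_mul_tsum_laguerreFun (hF : ∀ k, 0 ≤ F k) (hs : Summable F) (l : ℕ) :
    ∫ x in Set.Ioi 0, x ^ l * ((∑' k, F k * laguerreFun k x) * Real.exp (-x / 2))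
      = fockMoment F l := by
  have hint : ∀ k, IntegrableOn
      (fun x => x ^ l * (F k * laguerreFun k x * Real.exp (-x / 2))) (Set.Ioi 0) := fun k =>
    integrableOn_pow_mul_of_bounded (by fun_prop) (fun x hx => abs_mul_laguerreFun_le hF k hx) l
  have hI := integrableOn_pow_mul_exp_neg_mul l (r := 1 / 2) (by norm_num)
  have hsum : Summable fun k =>
      ∫ x in Set.Ioi 0, ‖x ^ l * (F k * laguerreFun k x * Real.exp (-x / 2))‖ := by
    refine Summable.of_nonneg_of_le (fun k => integral_nonneg fun x => norm_nonneg _)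
      (fun k => ?_)
      (hs.mul_right (∫ x in Set.Ioi 0, x ^ l * Real.exp (-(1 / 2 * x))))
    rw [← integral_const_mul]
    refine setIntegral_mono_on (hint k).norm (hI.const_mul _) measurableSet_Ioi fun x hx => ?_
    have hx' : 0 < x := hx
    rw [Real.norm_eq_abs, abs_mul, abs_mul, Real.abs_exp, abs_of_nonneg (pow_nonneg hx'.le l),
      show -x / 2 = -(1 / 2 * x) by ring, mul_left_comm]
    exact mul_le_mul_of_nonneg_right (abs_mul_laguerreFun_le hF k hx'.le) (by positivity)
  have h := hasSum_integral_of_summable_integral_norm hint hsum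
  have e1 : ∀ k, ∫ x in Set.Ioi 0, x ^ l * (F k * laguerreFun k x * Real.exp (-x / 2))
      = F k * (l.choose k : ℝ) * l.factorial := by
    intro k
    rw [mul_assoc, ← integral_pow_mul_laguerreFun, ← integral_const_mul]
    exact integral_congr_ae (Eventually.of_forall fun x => by ring)
  simp_rw [e1, tsum_mul_left, tsum_mul_right] at h
  refine h.unique ?_
  refine hasSum_sum_of_ne_finset_zero fun k hk => ?_
  rw [Nat.choose_eq_zero_of_lt (by simpa using hk)]
  simp

end LaguerreSeries

lemma posSemidef_stieltjesMatrix_fockMoment {F : ℕ → ℝ} (hF : ∀ k, 0 ≤ F k) (hs : Summable F)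
    (h : ∀ x, 0 ≤ x → 0 ≤ ∑' k, F k * laguerreFun k x) (m : ℕ) :
    (stieltjesMatrix (fockMoment F) m).PosSemidef :=
  posSemidef_stieltjesMatrix_of_moments
    (fun x hx => mul_nonneg (h x hx.le) (Real.exp_pos (-x / 2)).le)
    (integrableOn_pow_mul_of_bounded (continuousOn_tsum_mul_laguerreFun hF hs)
      fun _ hx => abs_tsum_mul_laguerreFun_le hF hs hx)
    (integral_pow_mul_tsum_laguerreFun hF hs) m

/-- A sequence is feasible for the linear program if and only if it is feasible for every
relaxation. -/
theorem lpFeasible_iff {F : ℕ → ℝ} :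
    LPFeasible F ↔ (∀ k, 0 ≤ F k) ∧ HasSum F 1 ∧
      ∀ m, (stieltjesMatrix (fockMoment F) m).PosSemidef := by
  constructor
  · intro h
    exact ⟨h.nonneg, h.hasSum_one,
      posSemidef_stieltjesMatrix_fockMoment h.nonneg h.hasSum_one.summable h.laguerre_nonneg⟩
  · rintro ⟨hF, h1, hP⟩
    refine ⟨?_, h1, hF, fun x hx => summable_mul_laguerreFun hF h1.summable hx, fun x hx => ?_⟩
    -- Square summability is automatic from ℓ¹ ⊆ ℓ².
    · have : Memℓp F 1 := memℓp_gen (by simpa using h1.summable.norm)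
      exact this.of_exponent_ge one_le_two
    · have hc := continuousOn_tsum_mul_laguerreFun hF h1.summable
      have hb := fun x (hx : 0 ≤ x) => abs_tsum_mul_laguerreFun_le hF h1.summable hx
      exact nonneg_of_integral_sq_eval_nonneg hc hb (integral_sq_eval_nonneg
        (integrableOn_pow_mul_of_bounded hc hb)
        (integral_pow_mul_tsum_laguerreFun hF h1.summable) hP) hx

/-! ### Moving mass to the vacuum -/

lemma fockMoment_congr {F G : ℕ → ℝ} {l : ℕ} (h : ∀ k ≤ l, F k = G k) :
    fockMoment F l = fockMoment G l :=
  Finset.sum_congr rfl fun k hk => by rw [h k (Nat.lt_succ_iff.mp (Finset.mem_range.mp hk))]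

lemma stieltjesMatrix_congr {μ ν : ℕ → ℝ} {m : ℕ} (h : ∀ l ≤ m, μ l = ν l) :
    stieltjesMatrix μ m = stieltjesMatrix ν m := by
  ext i j
  have hi := i.isLt
  have hj := j.isLt
  simp only [stieltjesMatrix, Matrix.of_apply]
  rw [h _ (by omega)]

lemma stieltjesMatrix_fockMoment_congr {F G : ℕ → ℝ} {m : ℕ} (h : ∀ k ≤ m, F k = G k) :
    stieltjesMatrix (fockMoment F) m = stieltjesMatrix (fockMoment G) m :=
  stieltjesMatrix_congr fun _ hl => fockMoment_congr fun k hk => h k (hk.trans hl)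

lemma posSemidef_stieltjesMatrix_mono {μ : ℕ → ℝ} {m m' : ℕ} (hm : m ≤ m')
    (h : (stieltjesMatrix μ m').PosSemidef) : (stieltjesMatrix μ m).PosSemidef :=
  h.submatrix (Fin.castLE (Nat.succ_le_succ hm))

/-- The sequence `F` with mass `c` added at the vacuum state. -/
def addVacuum (F : ℕ → ℝ) (c : ℝ) (k : ℕ) : ℝ := F k + if k = 0 then c else 0

lemma addVacuum_succ (F : ℕ → ℝ) (c : ℝ) (k : ℕ) : addVacuum F c (k + 1) = F (k + 1) := by
  simp [addVacuum]

lemma addVacuum_nonneg {F : ℕ → ℝ} {c : ℝ} (hF : ∀ k, 0 ≤ F k) (hc : 0 ≤ c) (k : ℕ) :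
    0 ≤ addVacuum F c k :=
  add_nonneg (hF k) (by split_ifs <;> simp [hc])

lemma fockMoment_addVacuum (F : ℕ → ℝ) (c : ℝ) (l : ℕ) :
    fockMoment (addVacuum F c) l = fockMoment F l + c * l.factorial := by
  simp [fockMoment, addVacuum, add_mul, Finset.sum_add_distrib]

lemma posSemidef_stieltjesMatrix_factorial (m : ℕ) :
    (stieltjesMatrix (fun l => (l.factorial : ℝ)) m).PosSemidef :=
  posSemidef_stieltjesMatrix_of_moments (w := fun x => Real.exp (-x))
    (fun x _ => (Real.exp_pos _).le)
    (fun l => by simpa using integrableOn_pow_mul_exp_neg_mul l one_pos)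
    integral_pow_mul_exp_neg m

/-- Vacuum mass c adds c · l! to the l-th moment, and l! are the moments of the positive density
e^{-x}. -/
lemma posSemidef_stieltjesMatrix_addVacuum {F : ℕ → ℝ} {c : ℝ} (hc : 0 ≤ c) {m : ℕ}
    (h : (stieltjesMatrix (fockMoment F) m).PosSemidef) :
    (stieltjesMatrix (fockMoment (addVacuum F c)) m).PosSemidef := by
  have e : stieltjesMatrix (fockMoment (addVacuum F c)) m
      = stieltjesMatrix (fockMoment F) m + c • stieltjesMatrix (fun l => (l.factorial : ℝ)) m := by
    ext i j
    simp only [stieltjesMatrix, Matrix.of_apply, Matrix.add_apply, Matrix.smul_apply,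
      fockMoment_addVacuum, smul_eq_mul]
    split_ifs <;> simp
  rw [e]
  exact h.add ((posSemidef_stieltjesMatrix_factorial m).smul hc)

/-! ### The relaxations in terms of sequences -/

/-- Feasible points of the relaxation of order `m`, as sequences supported on `{0, …, m}`. -/
structure RelaxedFeasible (m : ℕ) (F : ℕ → ℝ) : Prop where
  support_le : ∀ k, m < k → F k = 0
  sum_eq_one : ∑ k ∈ range (m + 1), F k = 1
  nonneg : ∀ k, 0 ≤ F k
  posSemidef : (stieltjesMatrix (fockMoment F) m).PosSemidef

lemma RelaxedFeasible.hasSum {m : ℕ} {F : ℕ → ℝ} (h : RelaxedFeasible m F) : HasSum F 1 := by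
  rw [← h.sum_eq_one]
  exact hasSum_sum_of_ne_finset_zero fun k hk => h.support_le k (by simpa using hk)

/-- The objective `∑_{k=1}^n a_k F_k`. -/
def weightedValue {n : ℕ} (a : Fin n → ℝ) (F : ℕ → ℝ) : ℝ :=
  ∑ i : Fin n, a i * F ((i : ℕ) + 1)

lemma sum_Iic_fin_eq {m : ℕ} (F : ℕ → ℝ) (l : Fin (m + 1)) :
    ∑ k ∈ Finset.Iic l, F k * ((l : ℕ).choose (k : ℕ) : ℝ) * ((l : ℕ).factorial : ℝ)
      = fockMoment F l := by
  unfold fockMoment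
  refine Finset.sum_bij (fun k _ => (k : ℕ)) (fun k hk => ?_) (fun a _ b _ h => Fin.ext h)
    (fun b hb => ?_) fun _ _ => rfl
  · simpa [Nat.lt_succ_iff] using hk
  · have hb' := Finset.mem_range.mp hb
    exact ⟨⟨b, by omega⟩, by simpa [Fin.le_def, Nat.lt_succ_iff] using hb', rfl⟩

lemma RelaxedFeasible.sdpFeasible {m : ℕ} {F : ℕ → ℝ} (h : RelaxedFeasible m F) :
    SDPFeasible m (stieltjesMatrix (fockMoment F) m) (fun k => F k) where
  isSymm := stieltjesMatrix_isSymm _ _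
  sum_eq_one := by rw [← h.sum_eq_one, Finset.sum_range]
  nonneg := fun k => h.nonneg k
  even_entries := fun l i j hij => by
    rw [sum_Iic_fin_eq]
    simp [stieltjesMatrix, hij]
  odd_entries := fun l _ _ i j hij => by
    have : ¬ Even ((i : ℕ) + j) := by
      rw [Nat.even_iff]; omega
    simp [stieltjesMatrix, this]
  posSemidef := h.posSemidef

/-- Extension of a finite sequence by zero. -/
def zeroExtend {m : ℕ} (F : Fin (m + 1) → ℝ) (k : ℕ) : ℝ :=
  if h : k < m + 1 then F ⟨k, h⟩ else 0

lemma zeroExtend_fin {m : ℕ} (F : Fin (m + 1) → ℝ) (k : Fin (m + 1)) :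
    zeroExtend F k = F k := by
  simp [zeroExtend, k.isLt]

/-- The entry constraints determine A completely from F, so the matrix variable can be eliminated.
-/
lemma SDPFeasible.relaxedFeasible {m : ℕ} {A : Matrix (Fin (m + 1)) (Fin (m + 1)) ℝ}
    {F : Fin (m + 1) → ℝ} (h : SDPFeasible m A F) : RelaxedFeasible m (zeroExtend F) where
  support_le := fun k hk => dif_neg (by omega)
  sum_eq_one := by
    rw [Finset.sum_range]
    simp_rw [zeroExtend_fin]
    exact h.sum_eq_one
  nonneg := fun k => by
    unfold zeroExtend
    split_ifs
    exacts [h.nonneg _, le_rfl]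
  posSemidef := by
    convert h.posSemidef
    ext i j
    have hi := i.isLt
    have hj := j.isLt
    simp only [stieltjesMatrix, Matrix.of_apply]
    split_ifs with he
    · obtain ⟨r, hr⟩ := he
      have h2 := h.even_entries ⟨r, by omega⟩ i j (by simp only; omega)
      have h3 := sum_Iic_fin_eq (zeroExtend F) (⟨r, by omega⟩ : Fin (m + 1))
      simp_rw [zeroExtend_fin] at h3
      rw [h2, h3]
      congr 1
      omega
    · have he' := Nat.not_even_iff.mp he
      -- An odd i + j ≤ 2m is at most 2m - 1, so its index (i + j + 1)/2 is within the allowed range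
      -- up to m.
      exact (h.odd_entries (((i : ℕ) + j + 1) / 2) (by omega) (by omega) i j (by omega)).symm

lemma sdpValuesWeighted_eq {n m : ℕ} (a : Fin n → ℝ) (hnm : n ≤ m) :
    sdpValuesWeighted a m = {v | ∃ F, RelaxedFeasible m F ∧ v = weightedValue a F} := by
  ext v
  constructor
  · rintro ⟨A, F, hF, _, rfl⟩
    refine ⟨zeroExtend F, hF.relaxedFeasible, Finset.sum_congr rfl fun i _ => ?_⟩
    rw [zeroExtend, dif_pos]
  · rintro ⟨F, hF, rfl⟩
    exact ⟨_, _, hF.sdpFeasible, hnm, rfl⟩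

/-- The matrix of order m only sees F_0, …, F_m, so truncation does not change it; the discarded
tail mass goes to the vacuum. -/
lemma relaxedFeasible_truncate {F : ℕ → ℝ} {m : ℕ} (hF : ∀ k, 0 ≤ F k) (h1 : HasSum F 1)
    (hP : (stieltjesMatrix (fockMoment F) m).PosSemidef) :
    RelaxedFeasible m (addVacuum (fun k => if k ≤ m then F k else 0)
      (1 - ∑ k ∈ range (m + 1), F k)) := by
  have hc : 0 ≤ 1 - ∑ k ∈ range (m + 1), F k :=
    sub_nonneg.mpr (sum_le_hasSum _ (fun k _ => hF k) h1)
  refine ⟨fun k hk => ?_, ?_, addVacuum_nonneg (fun k => ?_) hc,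
    posSemidef_stieltjesMatrix_addVacuum hc ?_⟩
  · simp [addVacuum, hk.not_ge, (Nat.zero_lt_of_lt hk).ne']
  · have : ∑ k ∈ range (m + 1), (if k ≤ m then F k else 0) = ∑ k ∈ range (m + 1), F k :=
      Finset.sum_congr rfl fun k hk => if_pos (Nat.lt_succ_iff.mp (Finset.mem_range.mp hk))
    simp [addVacuum, Finset.sum_add_distrib, this]
  · split_ifs
    exacts [hF k, le_rfl]
  · rwa [stieltjesMatrix_fockMoment_congr (G := F) fun k hk => if_pos hk]

lemma weightedValue_truncate {n m : ℕ} (a : Fin n → ℝ) (hnm : n ≤ m) (F : ℕ → ℝ) (c : ℝ) :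
    weightedValue a (addVacuum (fun k => if k ≤ m then F k else 0) c) = weightedValue a F := by
  refine Finset.sum_congr rfl fun i _ => ?_
  rw [addVacuum_succ, if_pos (by have := i.isLt; omega)]

lemma weightedValue_addVacuum {n : ℕ} (a : Fin n → ℝ) (F : ℕ → ℝ) (c : ℝ) :
    weightedValue a (addVacuum F c) = weightedValue a F :=
  Finset.sum_congr rfl fun i _ => by rw [addVacuum_succ]

lemma weightedValue_le_one {n : ℕ} {a : Fin n → ℝ} (ha : ∀ i, a i ∈ Set.Icc (0 : ℝ) 1)
    {F : ℕ → ℝ} (hF : ∀ k, 0 ≤ F k) (h1 : HasSum F 1) : weightedValue a F ≤ 1 := by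
  calc weightedValue a F ≤ ∑ i : Fin n, F ((i : ℕ) + 1) :=
        Finset.sum_le_sum fun i _ => mul_le_of_le_one_left (hF _) (ha i).2
    _ = ∑ k ∈ range n, F (k + 1) := (Finset.sum_range fun k => F (k + 1)).symm
    _ ≤ ∑ k ∈ range (n + 1), F k := by
        rw [Finset.sum_range_succ' F]
        exact le_add_of_nonneg_right (hF 0)
    _ ≤ 1 := sum_le_hasSum _ (fun k _ => hF k) h1

/-! ### Optimal values -/

lemma lpFeasible_vacuum : LPFeasible (addVacuum 0 1) := by
  refine lpFeasible_iff.mpr ⟨addVacuum_nonneg (fun _ => le_rfl) zero_le_one, ?_, fun m => ?_⟩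
  · have : addVacuum 0 1 = fun k => if k = 0 then (1 : ℝ) else 0 := by
      funext k; simp [addVacuum]
    rw [this]
    exact hasSum_ite_eq 0 1
  · have : stieltjesMatrix (fockMoment (addVacuum 0 1)) m
        = stieltjesMatrix (fun l => (l.factorial : ℝ)) m :=
      stieltjesMatrix_congr fun l _ => by rw [fockMoment_addVacuum]; simp [fockMoment]
    rw [this]
    exact posSemidef_stieltjesMatrix_factorial m

section Optimum

variable {n : ℕ} {a : Fin n → ℝ}

lemma isLUB_lpValuesWeighted (ha : ∀ i, a i ∈ Set.Icc (0 : ℝ) 1) :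
    IsLUB (lpValuesWeighted a) (lpOptWeighted a) := by
  refine isLUB_csSup ⟨_, _, lpFeasible_vacuum, rfl⟩ ⟨1, ?_⟩
  rintro v ⟨F, hF, rfl⟩
  exact weightedValue_le_one ha hF.nonneg hF.hasSum_one

lemma lpValuesWeighted_subset {m : ℕ} (hnm : n ≤ m) :
    lpValuesWeighted a ⊆ sdpValuesWeighted a m := by
  rw [sdpValuesWeighted_eq a hnm]
  rintro v ⟨F, hF, rfl⟩
  exact ⟨_, relaxedFeasible_truncate hF.nonneg hF.hasSum_one ((lpFeasible_iff.mp hF).2.2 m),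
    (weightedValue_truncate a hnm F _).symm⟩

lemma isLUB_sdpValuesWeighted (ha : ∀ i, a i ∈ Set.Icc (0 : ℝ) 1) {m : ℕ} (hnm : n ≤ m) :
    IsLUB (sdpValuesWeighted a m) (sdpOptWeighted a m) := by
  refine isLUB_csSup ⟨_, lpValuesWeighted_subset hnm ⟨_, lpFeasible_vacuum, rfl⟩⟩ ⟨1, ?_⟩
  rw [sdpValuesWeighted_eq a hnm]
  rintro v ⟨F, hF, rfl⟩
  exact weightedValue_le_one ha hF.nonneg hF.hasSum

lemma sdpValuesWeighted_subset {m m' : ℕ} (hnm : n ≤ m) (hm : m ≤ m') :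
    sdpValuesWeighted a m' ⊆ sdpValuesWeighted a m := by
  rw [sdpValuesWeighted_eq a hnm, sdpValuesWeighted_eq a (hnm.trans hm)]
  rintro v ⟨F, hF, rfl⟩
  exact ⟨_, relaxedFeasible_truncate hF.nonneg hF.hasSum
    (posSemidef_stieltjesMatrix_mono hm hF.posSemidef), (weightedValue_truncate a hnm F _).symm⟩

lemma sdpOptWeighted_anti (ha : ∀ i, a i ∈ Set.Icc (0 : ℝ) 1) {m m' : ℕ} (hnm : n ≤ m)
    (hm : m ≤ m') : sdpOptWeighted a m' ≤ sdpOptWeighted a m :=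
  (isLUB_sdpValuesWeighted ha (hnm.trans hm)).mono (isLUB_sdpValuesWeighted ha hnm)
    (sdpValuesWeighted_subset hnm hm)

lemma lpOptWeighted_le (ha : ∀ i, a i ∈ Set.Icc (0 : ℝ) 1) {m : ℕ} (hnm : n ≤ m) :
    lpOptWeighted a ≤ sdpOptWeighted a m :=
  (isLUB_lpValuesWeighted ha).mono (isLUB_sdpValuesWeighted ha hnm)
    (lpValuesWeighted_subset hnm)

/-! ### Convergence of the optimal values by compactness -/

/-- A pointwise limit of feasible points of relaxations of unbounded order is, once the lost
mass is returned to the vacuum, feasible for the linear program. -/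
lemma lpFeasible_of_tendsto {G : ℕ → ℕ → ℝ} {M : ℕ → ℕ} {F : ℕ → ℝ}
    (hM : Tendsto M atTop atTop) (hG : ∀ j, RelaxedFeasible (M j) (G j))
    (hlim : ∀ k, Tendsto (fun j => G j k) atTop (𝓝 (F k))) :
    LPFeasible (addVacuum F (1 - ∑' k, F k)) := by
  have hF : ∀ k, 0 ≤ F k := fun k => ge_of_tendsto' (hlim k) fun j => (hG j).nonneg k
  -- A Fatou-type bound: finite partial sums pass to the limit, but total mass may escape to
  -- infinity, so only `≤ 1` is available.
  have hle : ∀ s : Finset ℕ, ∑ k ∈ s, F k ≤ 1 := fun s =>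
    le_of_tendsto' (tendsto_finsetSum s fun k _ => hlim k) fun j =>
      sum_le_hasSum s (fun k _ => (hG j).nonneg k) (hG j).hasSum
  have hs : Summable F := summable_of_sum_le hF hle
  have hc : 0 ≤ 1 - ∑' k, F k := sub_nonneg.mpr (hs.tsum_le_of_sum_le hle)
  refine lpFeasible_iff.mpr ⟨addVacuum_nonneg hF hc, ?_, fun m =>
    posSemidef_stieltjesMatrix_addVacuum hc ?_⟩
  · have := hs.hasSum.add (hasSum_ite_eq 0 (1 - ∑' k, F k))
    rwa [add_sub_cancel] at this
  -- For fixed m, each matrix entry involves finitely many coordinates, so the quadratic form is a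
  -- limit of values that are non-negative once the order exceeds m.
  · rw [posSemidef_stieltjesMatrix_iff]
    intro v
    have hmom : ∀ l, Tendsto (fun j => fockMoment (G j) l) atTop (𝓝 (fockMoment F l)) := fun l =>
      tendsto_finsetSum _ fun k _ => ((hlim k).mul_const _).mul_const _
    have hent : ∀ i j : Fin (m + 1), Tendsto (fun N => stieltjesMatrix (fockMoment (G N)) m i j)
        atTop (𝓝 (stieltjesMatrix (fockMoment F) m i j)) := by
      intro i j
      simp only [stieltjesMatrix, Matrix.of_apply]
      split_ifs
      exacts [hmom _, tendsto_const_nhds]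
    refine ge_of_tendsto (tendsto_finsetSum _ fun i _ => tendsto_finsetSum _ fun j _ =>
      (hent i j).const_mul (v i * v j)) ?_
    filter_upwards [hM.eventually_ge_atTop m] with N hN
    exact (posSemidef_stieltjesMatrix_iff _ _).mp
      (posSemidef_stieltjesMatrix_mono hN (hG N).posSemidef) v

theorem tendsto_sdpOptWeighted (ha : ∀ i, a i ∈ Set.Icc (0 : ℝ) 1) :
    Tendsto (fun m => sdpOptWeighted a m) atTop (𝓝 (lpOptWeighted a)) := by
  -- The orders are shifted by n: for m < n the set of values is empty and its `sSup` is the default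
  -- 0, so monotonicity can fail there.
  have hanti : Antitone fun d => sdpOptWeighted a (n + d) := fun d e hde =>
    sdpOptWeighted_anti ha (Nat.le_add_right n d) (Nat.add_le_add_left hde n)
  have hbdd : ∀ d, lpOptWeighted a ≤ sdpOptWeighted a (n + d) := fun d =>
    lpOptWeighted_le ha (Nat.le_add_right n d)
  have hconv := tendsto_atTop_ciInf hanti ⟨_, Set.forall_mem_range.mpr hbdd⟩
  set L := ⨅ d, sdpOptWeighted a (n + d) with hL
  -- Near-optimal points with vanishing gap 1/(d + 1) suffice, so attainment of the suprema is not
  -- required.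
  have hex : ∀ d : ℕ, ∃ F, RelaxedFeasible (n + d) F ∧
      sdpOptWeighted a (n + d) - 1 / ((d : ℝ) + 1) < weightedValue a F := by
    intro d
    obtain ⟨v, hv, hlt, -⟩ := (isLUB_sdpValuesWeighted ha (Nat.le_add_right n d)).exists_between
      (sub_lt_self _ (by positivity : (0 : ℝ) < 1 / ((d : ℝ) + 1)))
    rw [sdpValuesWeighted_eq a (Nat.le_add_right n d)] at hv
    obtain ⟨F, hF, rfl⟩ := hv
    exact ⟨F, hF, hlt⟩
  choose G hG hGv using hex
  have hmem : ∀ d, G d ∈ Set.univ.pi fun _ : ℕ => Set.Icc (0 : ℝ) 1 := fun d k _ =>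
    ⟨(hG d).nonneg k, le_hasSum (hG d).hasSum k fun i _ => (hG d).nonneg i⟩
  -- Tychonoff gives compactness, and the countable product is first countable, so a convergent
  -- subsequence exists.
  obtain ⟨F, -, ψ, hψ, hψlim⟩ :=
    (isCompact_univ_pi fun _ : ℕ => isCompact_Icc).tendsto_subseq hmem
  have hlim : ∀ k, Tendsto (fun j => G (ψ j) k) atTop (𝓝 (F k)) := tendsto_pi_nhds.mp hψlim
  have hfeas := lpFeasible_of_tendsto (M := fun j => n + ψ j)
    (tendsto_atTop_mono (fun j => Nat.le_add_left _ n) hψ.tendsto_atTop) (fun j => hG (ψ j)) hlim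
  have hval : weightedValue a F ≤ lpOptWeighted a := by
    rw [← weightedValue_addVacuum a F (1 - ∑' k, F k)]
    exact (isLUB_lpValuesWeighted ha).1 ⟨_, hfeas, rfl⟩
  have hLle : L ≤ weightedValue a F := by
    have h1 : Tendsto (fun j => weightedValue a (G (ψ j))) atTop (𝓝 (weightedValue a F)) :=
      tendsto_finsetSum _ fun i _ => (hlim _).const_mul _
    have h2 := (hconv.sub tendsto_one_div_add_atTop_nhds_zero_nat).comp hψ.tendsto_atTop
    rw [sub_zero] at h2
    exact le_of_tendsto_of_tendsto' h2 h1 fun j => (hGv (ψ j)).le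
  have hLeq : L = lpOptWeighted a := le_antisymm (hLle.trans hval) (le_ciInf hbdd)
  rw [hLeq] at hconv
  refine (tendsto_add_atTop_iff_nat n).mp ?_
  simpa only [add_comm] using hconv

/-- The hierarchy of relaxations for a weighted objective converges. -/
theorem weighted_hierarchy (ha : ∀ i, a i ∈ Set.Icc (0 : ℝ) 1) :
    IsLUB (lpValuesWeighted a) (lpOptWeighted a) ∧
      (∀ m, n ≤ m → IsLUB (sdpValuesWeighted a m) (sdpOptWeighted a m)) ∧
      AntitoneOn (fun m => sdpOptWeighted a m) (Set.Ici n) ∧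
      (∀ m, n ≤ m → lpOptWeighted a ≤ sdpOptWeighted a m) ∧
      Tendsto (fun m => sdpOptWeighted a m) atTop (𝓝 (lpOptWeighted a)) :=
  ⟨isLUB_lpValuesWeighted ha, fun _ hm => isLUB_sdpValuesWeighted ha hm,
    fun _ hm _ _ hmm => sdpOptWeighted_anti ha hm hmm, fun _ hm => lpOptWeighted_le ha hm,
    tendsto_sdpOptWeighted ha⟩

end Optimum

/-! ### The single Fock state objective as a weighted one -/

/-- The weight vector selecting the last coordinate. -/
def lastWeight (n : ℕ) (i : Fin n) : ℝ := if (i : ℕ) + 1 = n then 1 else 0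

lemma sum_lastWeight_mul {n : ℕ} (hn : 1 ≤ n) (b : Fin n → ℝ) :
    ∑ i, lastWeight n i * b i = b ⟨n - 1, by omega⟩ := by
  rw [Finset.sum_eq_single ⟨n - 1, by omega⟩]
  · simp [lastWeight, Nat.sub_add_cancel hn]
  · intro i _ hi
    have : (i : ℕ) + 1 ≠ n := fun h => hi (Fin.ext (by simp only; omega))
    simp [lastWeight, this]
  · simp

lemma lpValues_eq_weighted {n : ℕ} (hn : 1 ≤ n) :
    lpValues n = lpValuesWeighted (lastWeight n) := by
  simp only [lpValues, lpValuesWeighted,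
    sum_lastWeight_mul hn fun i : Fin n => (_ : ℕ → ℝ) ((i : ℕ) + 1), Nat.sub_add_cancel hn]

lemma sdpValues_eq_weighted {n : ℕ} (hn : 1 ≤ n) (m : ℕ) :
    sdpValues n m = sdpValuesWeighted (lastWeight n) m := by
  ext v
  simp only [sdpValues, sdpValuesWeighted, Set.mem_ofPred_eq]
  refine exists_congr fun A => exists_congr fun F => and_congr_right fun _ =>
    exists_congr fun h => ?_
  rw [sum_lastWeight_mul hn fun i : Fin n => F ⟨(i : ℕ) + 1, _⟩]
  simp only [Nat.sub_add_cancel hn]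

end WignerHierarchy

theorem mainTheorem1 (n : ℕ) (hn : 1 ≤ n) :
    -- the programs for a single Fock state; the optimal values are genuine finite suprema
    (IsLUB (WignerHierarchy.lpValues n) (WignerHierarchy.lpOpt n) ∧
      (∀ m, n ≤ m → IsLUB (WignerHierarchy.sdpValues n m) (WignerHierarchy.sdpOpt n m)) ∧
      AntitoneOn (fun m => WignerHierarchy.sdpOpt n m) (Set.Ici n) ∧
      (∀ m, n ≤ m → WignerHierarchy.lpOpt n ≤ WignerHierarchy.sdpOpt n m) ∧
      Tendsto (fun m => WignerHierarchy.sdpOpt n m) atTop (𝓝 (WignerHierarchy.lpOpt n))) ∧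
    -- the programs for weighted witnesses
    (∀ a : Fin n → ℝ, (∀ i, a i ∈ Set.Icc (0 : ℝ) 1) →
      IsLUB (WignerHierarchy.lpValuesWeighted a) (WignerHierarchy.lpOptWeighted a) ∧
      (∀ m, n ≤ m →
        IsLUB (WignerHierarchy.sdpValuesWeighted a m) (WignerHierarchy.sdpOptWeighted a m)) ∧
      AntitoneOn (fun m => WignerHierarchy.sdpOptWeighted a m) (Set.Ici n) ∧
      (∀ m, n ≤ m →
        WignerHierarchy.lpOptWeighted a ≤ WignerHierarchy.sdpOptWeighted a m) ∧
      Tendsto (fun m => WignerHierarchy.sdpOptWeighted a m) atTop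
        (𝓝 (WignerHierarchy.lpOptWeighted a))) := by
  refine ⟨?_, fun a ha => WignerHierarchy.weighted_hierarchy ha⟩
  have h := WignerHierarchy.weighted_hierarchy (a := WignerHierarchy.lastWeight n) fun i => by
    unfold WignerHierarchy.lastWeight
    split_ifs <;> simp
  simpa only [WignerHierarchy.lpOpt, WignerHierarchy.sdpOpt, WignerHierarchy.lpOptWeighted,
    WignerHierarchy.sdpOptWeighted, WignerHierarchy.lpValues_eq_weighted hn,
    WignerHierarchy.sdpValues_eq_weighted hn] using h
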